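/- For $n\ge 1$ and $s,c\in\{0,1\}^n$ let $\mathcal C_s=\prod_{i=1}^n[s_i-2,s_i+1]\subset\mathbb R^n$, $K_s=\mathcal C_s\times[0,1]^n\subset\mathbb R^{2n}$, and $$f_c(x)=\sum_{i=1}^{n}x_i+\max_{n<i\le 2n}|x_i-c_{i-n}|\qquad(x\in\mathbb R^{2n}).$$ Then $K_s$ is a convex body and $f_c$ is convex on it. Consider quantum query algorithms that do not know $s,c$ and access them only through the membership oracle $O_{K_s}|x,b\rangle=|x,b\oplus\delta[x\in K_s]\rangle$ ($x\in\mathbb R^{2n}$, $b\in\{0,1\}$) and the evaluation oracle $O_{f_c}|x,y\rangle=|x,y+f_c(x)\rangle$ ($x\in\mathbb R^{2n}$, $y\in\mathbb R$), interleaved with arbitrary unitaries independent of $s,c$ on these registers and an arbitrary workspace, and followed by a measurement. There is an absolute constant $C>0$ such that for every $n\ge 2$ the following holds: any such algorithm that, for all $s,c\in\{0,1\}^n$, outputs with probability at least $0.8$ a point $\tilde x\in K_s$ with $$f_c(\tilde x)\le\min_{x\in K_s}f_c(x)+\tfrac13$$ makes at least $C\sqrt n$ membership queries and at least $C\sqrt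 n/\log n$ evaluation queries (both bounds hold for the same algorithm). In other words, $\Omega(\sqrt n)$ membership queries and $\Omega(\sqrt n/\log n)$ evaluation queries are necessary. -/

import Mathlib

/-! ### Quantum query algorithms with a membership oracle and an evaluation oracle -/

/-- The Hilbert space `ℓ²(ι)` whose orthonormal basis vectors are the kets `|i⟩`, `i : ι`. -/
abbrev KetSpace (ι : Type*) : Type _ := lp (fun _ : ι => ℂ) 2

/-- The ket `|i⟩`. -/
noncomputable def ket {ι : Type*} [DecidableEq ι] (i : ι) : KetSpace ι :=
  lp.single 2 i (1 : ℂ)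

theorem memlp_two_comp_perm {ι : Type*} (e : Equiv.Perm ι) {f : ι → ℂ}
    (hf : Memℓp (E := fun _ : ι => ℂ) f 2) :
    Memℓp (E := fun _ : ι => ℂ) (fun i => f (e.symm i)) 2 := by
  have h2 : 0 < (2 : ENNReal).toReal := by norm_num
  rw [memℓp_gen_iff h2] at hf ⊢
  exact (e.symm.summable_iff (f := fun i => ‖f i‖ ^ (2 : ENNReal).toReal)).2 hf

/-- The unitary operator that permutes the kets: `|i⟩ ↦ |e i⟩`. -/
noncomputable def permUnitary {ι : Type*} (e : Equiv.Perm ι) :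
    KetSpace ι ≃ₗᵢ[ℂ] KetSpace ι where
  toFun ψ := ⟨fun i => ψ (e.symm i), memlp_two_comp_perm e (lp.memℓp ψ)⟩
  invFun ψ := ⟨fun i => ψ (e i), memlp_two_comp_perm e.symm (lp.memℓp ψ)⟩
  map_add' _ _ := rfl
  map_smul' _ _ := rfl
  left_inv ψ := by
    ext i
    exact congrArg (fun j => ψ j) (e.symm_apply_apply i)
  right_inv ψ := by
    ext i
    exact congrArg (fun j => ψ j) (e.apply_symm_apply i)
  norm_map' ψ := by
    have h2 : 0 < (2 : ENNReal).toReal := by norm_num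
    rw [lp.norm_eq_tsum_rpow h2, lp.norm_eq_tsum_rpow h2]
    exact congrArg (fun t : ℝ => t ^ (1 / (2 : ENNReal).toReal))
      (e.symm.tsum_eq (fun i => ‖ψ i‖ ^ (2 : ENNReal).toReal))

/-- `permUnitary e` maps `|i⟩` to `|e i⟩`. -/
theorem permUnitary_ket {ι : Type*} [DecidableEq ι] (e : Equiv.Perm ι) (i : ι) :
    permUnitary e (ket i) = ket (e i) := by
  ext j
  change lp.single (E := fun _ : ι => ℂ) 2 i (1 : ℂ) (e.symm j) =
    lp.single (E := fun _ : ι => ℂ) 2 (e i) (1 : ℂ) j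
  simp only [lp.single_apply, Pi.single_apply, Equiv.symm_apply_eq]

/-- Basis labels `(x, b, y, w)`: query register `x`, one-bit answer register `b` for membership
queries, real answer register `y` for evaluation queries, and workspace `w`. -/
abbrev Label (X W : Type*) : Type _ := X × Bool × ℝ × W

open Classical in
/-- Action of a membership query to `K` on labels: `(x, b, y, w) ↦ (x, b ⊕ δ[x ∈ K], y, w)`. -/
noncomputable def memPerm {X : Type*} (W : Type*) (K : Set X) : Equiv.Perm (Label X W) where
  toFun := fun ⟨x, b, y, w⟩ => (x, xor b (decide (x ∈ K)), y, w)
  invFun := fun ⟨x, b, y, w⟩ => (x, xor b (decide (x ∈ K)), y, w)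
  left_inv := fun ⟨x, b, y, w⟩ => by simp
  right_inv := fun ⟨x, b, y, w⟩ => by simp

/-- Action of an evaluation query to `f` on labels: `(x, b, y, w) ↦ (x, b, y + f x, w)`. -/
def evalPerm {X : Type*} (W : Type*) (f : X → ℝ) : Equiv.Perm (Label X W) where
  toFun := fun ⟨x, b, y, w⟩ => (x, b, y + f x, w)
  invFun := fun ⟨x, b, y, w⟩ => (x, b, y - f x, w)
  left_inv := fun ⟨x, b, y, w⟩ => by simp
  right_inv := fun ⟨x, b, y, w⟩ => by simp

/-- The two kinds of oracle queries. -/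
inductive QueryKind : Type
  | mem
  | eval
  deriving DecidableEq

/-- The oracle unitaries: `O_K |x, b, y, w⟩ = |x, b ⊕ δ[x ∈ K], y, w⟩` and
`O_f |x, b, y, w⟩ = |x, b, y + f x, w⟩`. -/
noncomputable def oracle {X : Type*} (W : Type*) (K : Set X) (f : X → ℝ) :
    QueryKind → (KetSpace (Label X W) ≃ₗᵢ[ℂ] KetSpace (Label X W))
  | QueryKind.mem => permUnitary (memPerm W K)
  | QueryKind.eval => permUnitary (evalPerm W f)

/-- A quantum query algorithm on query points `X` with workspace labels `W`: it starts in a fixed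
unit vector, alternates oracle queries with fixed unitaries that do not depend on the oracles
(each step is one query followed by one unitary), finally measures in the basis of kets and outputs
a point of `X` computed from the measured label. -/
structure QuantumAlgorithm (X W : Type*) where
  init : KetSpace (Label X W)
  norm_init : ‖init‖ = 1
  steps : List (QueryKind × (KetSpace (Label X W) ≃ₗᵢ[ℂ] KetSpace (Label X W)))
  output : Label X W → X

namespace QuantumAlgorithm

variable {X W : Type*}

/-- The state just before the final measurement, when run with the oracles for `K` and `f`. -/
noncomputable def finalState (A : QuantumAlgorithm X W) (K : Set X) (f : X → ℝ) :
    KetSpace (Label X W) :=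
  A.steps.foldl (fun ψ p => p.2 (oracle W K f p.1 ψ)) A.init

open Classical in
/-- The probability that the output lies in `S`, when run with the oracles for `K` and `f`. -/
noncomputable def outputProb (A : QuantumAlgorithm X W) (K : Set X) (f : X → ℝ) (S : Set X) : ℝ :=
  ∑' i : Label X W, if A.output i ∈ S then ‖A.finalState K f i‖ ^ 2 else 0

/-- The number of membership queries. -/
def memQueries (A : QuantumAlgorithm X W) : ℕ :=
  A.steps.countP (fun p => p.1 = QueryKind.mem)

/-- The number of evaluation queries. -/
def evalQueries (A : QuantumAlgorithm X W) : ℕ :=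
  A.steps.countP (fun p => p.1 = QueryKind.eval)

end QuantumAlgorithm

/-! ### The optimization problem -/

/-- The points of `K` that minimize `f` over `K` up to an additive error `ε`. -/
def approxMinimizers {X : Type*} (K : Set X) (f : X → ℝ) (ε : ℝ) : Set X :=
  {x | x ∈ K ∧ ∀ y ∈ K, f x ≤ f y + ε}

/-- The numerical value `0` or `1` of a bit. -/
def bitVal (b : Bool) : ℝ := if b then 1 else 0

/-- Points of `ℝ²ⁿ`, split into the first `n` and the last `n` coordinates. -/
abbrev Point (n : ℕ) : Type := (Fin n → ℝ) × (Fin n → ℝ)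

/-- The cube `C_s`, the product of the intervals `[s i - 2, s i + 1]`. -/
def shiftedCube {n : ℕ} (s : Fin n → Bool) : Set (Fin n → ℝ) :=
  Set.univ.pi fun i => Set.Icc (bitVal (s i) - 2) (bitVal (s i) + 1)

/-- The unit cube `[0,1]ⁿ`. -/
def unitCube (n : ℕ) : Set (Fin n → ℝ) :=
  Set.univ.pi fun _ => Set.Icc (0 : ℝ) 1

/-- The convex body `C_s × [0,1]ⁿ`. -/
def body {n : ℕ} (s : Fin n → Bool) : Set (Point n) :=
  shiftedCube s ×ˢ unitCube n

/-- The objective: the sum of the first `n` coordinates plus the maximal distance of the last `n`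
coordinates from the bits `c i`. -/
noncomputable def objective {n : ℕ} (c : Fin n → Bool) (x : Point n) : ℝ :=
  (∑ i, x.1 i) + ⨆ i, |x.2 i - bitVal (c i)|

open scoped InnerProductSpace

/-! ### Geometry of the bodies and of the objectives -/

/-! The proof is a weighted quantum adversary argument on the hypercube. Fixing `c` and varying `s`
makes evaluation queries uninformative; fixing `s` and varying `c` does the same for membership
queries. So each kind of query can be counted on its own, whatever the number of the other kind.

The potential is `edgeOverlap`, the sum of the real inner products of the states over ordered pairs
of adjacent bit strings. It starts at `n * 2 ^ n`. Adjacent strings have disjoint sets of correct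
outputs (`eq_of_mem_approxMinimizers`), so success forces it below `4 / 5` of that
(`re_inner_le_of_disjoint`).

One query lowers it by at most `4 * √n * 2 ^ n` (`edgeOverlap_sub_le`). The reason is an asymmetry:
at a fixed query point, at most one bit flip decreases the objective, or turns a non-member into a
member. An edge gets weight `√n` at its end with the larger value and `1 / √n` at the other, so the
weights at one string and point sum to at most `n / √n + √n = 2 * √n`. Dividing gives `√n / 20`
queries of each kind; for evaluations this is stronger than required. -/

theorem convex_body {n : ℕ} (s : Fin n → Bool) : Convex ℝ (body s) :=
  (convex_pi fun _ _ => convex_Icc _ _).prod (convex_pi fun _ _ => convex_Icc _ _)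

theorem isCompact_body {n : ℕ} (s : Fin n → Bool) : IsCompact (body s) :=
  (isCompact_univ_pi fun _ => isCompact_Icc).prod (isCompact_univ_pi fun _ => isCompact_Icc)

theorem interior_body_nonempty {n : ℕ} (s : Fin n → Bool) : (interior (body s)).Nonempty := by
  refine ⟨(fun i => bitVal (s i), fun _ => 1 / 2), ?_⟩
  rw [body, interior_prod_eq, shiftedCube, unitCube, interior_pi_set Set.finite_univ,
    interior_pi_set Set.finite_univ]
  simp only [interior_Icc, Set.mem_prod, Set.mem_pi, Set.mem_univ, Set.mem_Ioo, true_implies]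
  exact ⟨fun i => ⟨by linarith, by linarith⟩, fun i => ⟨by norm_num, by norm_num⟩⟩

theorem abs_sub_bitVal_le_iSup {n : ℕ} (c : Fin n → Bool) (y : Fin n → ℝ) (i : Fin n) :
    |y i - bitVal (c i)| ≤ ⨆ j, |y j - bitVal (c j)| :=
  le_ciSup (f := fun j => |y j - bitVal (c j)|) (Set.finite_range _).bddAbove i

theorem convexOn_objective {n : ℕ} (s c : Fin n → Bool) :
    ConvexOn ℝ (body s) (objective c) := by
  refine ⟨convex_body s, fun x _ y _ a b ha hb hab => ?_⟩
  have hsum : ∑ i, (a • x + b • y).1 i = a * ∑ i, x.1 i + b * ∑ i, y.1 i := by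
    simp [Finset.sum_add_distrib, Finset.mul_sum]
  have hsup : (⨆ i, |(a • x + b • y).2 i - bitVal (c i)|) ≤
      a * (⨆ i, |x.2 i - bitVal (c i)|) + b * ⨆ i, |y.2 i - bitVal (c i)| := by
    have nonneg (z : Fin n → ℝ) : 0 ≤ ⨆ i, |z i - bitVal (c i)| :=
      Real.iSup_nonneg fun i => abs_nonneg _
    refine Real.iSup_le (fun i => ?_)
      (add_nonneg (mul_nonneg ha (nonneg _)) (mul_nonneg hb (nonneg _)))
    have key : (a • x + b • y).2 i - bitVal (c i) =
        a * (x.2 i - bitVal (c i)) + b * (y.2 i - bitVal (c i)) := by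
      simp only [Prod.snd_add, Prod.smul_snd, Pi.add_apply, Pi.smul_apply, smul_eq_mul]
      linear_combination bitVal (c i) * hab
    rw [key]
    refine (abs_add_le _ _).trans ?_
    rw [abs_mul, abs_mul, abs_of_nonneg ha, abs_of_nonneg hb]
    exact add_le_add (mul_le_mul_of_nonneg_left (abs_sub_bitVal_le_iSup c x.2 i) ha)
      (mul_le_mul_of_nonneg_left (abs_sub_bitVal_le_iSup c y.2 i) hb)
  simp only [objective, smul_eq_mul]
  rw [hsum]
  linarith

/-- An approximate minimizer reveals both bit strings. -/
theorem near_of_mem_approxMinimizers {n : ℕ} {s c : Fin n → Bool} {x : Point n}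
    (hx : x ∈ approxMinimizers (body s) (objective c) (1 / 3)) (i : Fin n) :
    |x.1 i - (bitVal (s i) - 2)| ≤ 1 / 3 ∧ |x.2 i - bitVal (c i)| ≤ 1 / 3 := by
  obtain ⟨hxK, hmin⟩ := hx
  have hbit (b : Bool) : 0 ≤ bitVal b ∧ bitVal b ≤ 1 := by cases b <;> simp [bitVal]
  -- Comparison with the exact minimizer: each first-half coordinate is at its lower end and the
  -- maximum vanishes.
  have hopt := hmin (fun i => bitVal (s i) - 2, fun i => bitVal (c i))
    ⟨fun i _ => ⟨le_rfl, by linarith⟩, fun i _ => hbit _⟩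
  have hlow (j : Fin n) : 0 ≤ x.1 j - (bitVal (s j) - 2) :=
    sub_nonneg.2 (hxK.1 j trivial).1
  have hsup := abs_sub_bitVal_le_iSup c x.2 i
  -- The excesses over the lower ends are nonnegative and sum to at most `1 / 3`, so each one is at
  -- most `1 / 3`.
  have hterm := Finset.single_le_sum (fun j _ => hlow j) (Finset.mem_univ i)
  simp only [objective, sub_self, abs_zero, Real.iSup_const_zero, add_zero] at hopt
  rw [Finset.sum_sub_distrib] at hterm
  have hs := hlow i
  have habs := abs_nonneg (x.2 i - bitVal (c i))
  rw [abs_of_nonneg hs]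
  constructor <;> linarith

theorem eq_of_abs_sub_bitVal_le {a b : Bool} {t : ℝ} (ha : |t - bitVal a| ≤ 1 / 3)
    (hb : |t - bitVal b| ≤ 1 / 3) : a = b := by
  rw [abs_le] at ha hb
  cases a <;> cases b <;> simp only [bitVal] at * <;> norm_num at * <;> linarith

/-- Distinct bit values are `1` apart, more than twice the error `1 / 3`, so rounding recovers the
strings. This makes the success sets of different instances disjoint. -/
theorem eq_of_mem_approxMinimizers {n : ℕ} {s c s' c' : Fin n → Bool} {x : Point n}
    (hx : x ∈ approxMinimizers (body s) (objective c) (1 / 3))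
    (hx' : x ∈ approxMinimizers (body s') (objective c') (1 / 3)) : s = s' ∧ c = c' := by
  refine ⟨funext fun i => ?_, funext fun i => ?_⟩
  · refine eq_of_abs_sub_bitVal_le (t := x.1 i + 2) ?_ ?_
    · convert (near_of_mem_approxMinimizers hx i).1 using 2; ring
    · convert (near_of_mem_approxMinimizers hx' i).1 using 2; ring
  · exact eq_of_abs_sub_bitVal_le (near_of_mem_approxMinimizers hx i).2
      (near_of_mem_approxMinimizers hx' i).2

/-! ### Flipping one bit -/

/-- The bit string `c` with its bit at `i` flipped. -/
def flipBit {n : ℕ} (i : Fin n) (c : Fin n → Bool) : Fin n → Bool :=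
  Function.update c i (!c i)

theorem flipBit_of_ne {n : ℕ} {i j : Fin n} (h : j ≠ i) (c : Fin n → Bool) :
    flipBit i c j = c j :=
  Function.update_of_ne h _ _

theorem flipBit_involutive {n : ℕ} (i : Fin n) : Function.Involutive (flipBit i) := by
  intro c
  simp [flipBit]

theorem flipBit_ne {n : ℕ} (i : Fin n) (c : Fin n → Bool) : flipBit i c ≠ c := by
  intro h
  simpa [flipBit] using congrFun h i

/-- At most one bit flip decreases the objective at a given point. -/
theorem exists_forall_ne_objective_le {n : ℕ} [Nonempty (Fin n)] (c : Fin n → Bool)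
    (x : Point n) : ∃ j, ∀ i ≠ j, objective c x ≤ objective (flipBit i c) x := by
  obtain ⟨j, hj⟩ := exists_eq_ciSup_of_finite (f := fun j => |x.2 j - bitVal (c j)|)
  -- A flip away from a coordinate `j` attaining the maximum leaves that term in place, so the
  -- maximum cannot drop.
  refine ⟨j, fun i hij => add_le_add_right ?_ _⟩
  rw [← hj]
  have h := abs_sub_bitVal_le_iSup (flipBit i c) x.2 j
  rwa [flipBit_of_ne hij.symm] at h

open Classical in
/-- The indicator of non-membership in `body s`. -/
noncomputable def nonMembership {n : ℕ} (s : Fin n → Bool) (x : Point n) : ℝ :=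
  if x ∈ body s then 0 else 1

/-- At most one bit flip turns a given point from a non-member into a member. -/
theorem exists_forall_ne_nonMembership_le {n : ℕ} [Nonempty (Fin n)] (s : Fin n → Bool)
    (x : Point n) : ∃ j, ∀ i ≠ j, nonMembership s x ≤ nonMembership (flipBit i s) x := by
  by_cases hx : x ∈ body s
  · refine ⟨Classical.arbitrary _, fun i _ => ?_⟩
    simp only [nonMembership, if_pos hx]
    split_ifs <;> norm_num
  · have hj : ∃ j, ∀ i ≠ j, x ∉ body (flipBit i s) := by
      -- If the second half is outside the unit cube, no flip helps. Otherwise some coordinate `j`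
      -- violates its interval, and only flipping `s j` can repair that.
      by_cases hx2 : x.2 ∈ unitCube n
      · have hx1 : ∃ j, x.1 j ∉ Set.Icc (bitVal (s j) - 2) (bitVal (s j) + 1) := by
          by_contra! h
          exact hx ⟨fun j _ => h j, hx2⟩
        obtain ⟨j, hj⟩ := hx1
        refine ⟨j, fun i hij h => hj ?_⟩
        simpa only [flipBit_of_ne hij.symm] using h.1 j trivial
      · exact ⟨Classical.arbitrary _, fun i _ h => hx2 h.2⟩
    obtain ⟨j, hj⟩ := hj
    refine ⟨j, fun i hij => ?_⟩
    simp [nonMembership, hx, hj i hij]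

/-! ### The adversary bound -/

theorem summable_norm_sq {ι : Type*} (ψ : KetSpace ι) : Summable fun l => ‖ψ l‖ ^ 2 := by
  have h2 : 0 < (2 : ENNReal).toReal := by norm_num
  simpa using (memℓp_gen_iff h2).1 (lp.memℓp ψ)

theorem tsum_norm_sq {ι : Type*} (ψ : KetSpace ι) : ∑' l, ‖ψ l‖ ^ 2 = ‖ψ‖ ^ 2 := by
  have h2 : 0 < (2 : ENNReal).toReal := by norm_num
  simpa using (lp.norm_rpow_eq_tsum h2 ψ).symm

theorem hasSum_re_inner {ι : Type*} (φ ψ : KetSpace ι) :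
    HasSum (fun l => (⟪φ l, ψ l⟫_ℂ).re) (⟪φ, ψ⟫_ℂ).re :=
  Complex.hasSum_re (lp.hasSum_inner φ ψ)

theorem abs_re_inner_le_norm_mul (z w : ℂ) : |(⟪z, w⟫_ℂ).re| ≤ ‖z‖ * ‖w‖ :=
  (Complex.abs_re_le_norm _).trans (norm_inner_le_norm z w)

/-- A non-negative weight bounded by `B` keeps `‖ψ l‖ ^ 2` summable. -/
theorem summable_weight_mul_norm_sq {ι : Type*} {u : ι → ℝ} {B : ℝ} (hu : ∀ l, 0 ≤ u l)
    (huB : ∀ l, u l ≤ B) (ψ : KetSpace ι) : Summable fun l => u l * ‖ψ l‖ ^ 2 :=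
  Summable.of_nonneg_of_le (fun l => mul_nonneg (hu l) (sq_nonneg _))
    (fun l => mul_le_mul_of_nonneg_right (huB l) (sq_nonneg _)) ((summable_norm_sq ψ).mul_left B)

/-- Two permutations that agree off the support of `u`, and preserve `u` and `v`, change the inner
product by at most the weighted masses, where `u` and `v` are inverse to each other on the support
of `u`. -/
theorem re_inner_sub_re_inner_permUnitary_le {ι : Type*} (p q : Equiv.Perm ι) {u v : ι → ℝ}
    {B : ℝ} (hu : ∀ l, 0 ≤ u l) (hv : ∀ l, 0 ≤ v l) (huB : ∀ l, u l ≤ B) (hvB : ∀ l, v l ≤ B)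
    (hup : ∀ l, u (p l) = u l) (hvp : ∀ l, v (p l) = v l) (hvq : ∀ l, v (q l) = v l)
    (huv : ∀ l, u l = 0 ∧ p.symm l = q.symm l ∨ u l * v l = 1) (φ ψ : KetSpace ι) :
    (⟪φ, ψ⟫_ℂ).re - (⟪permUnitary p φ, permUnitary q ψ⟫_ℂ).re ≤
      ∑' l, u l * ‖φ l‖ ^ 2 + ∑' l, v l * ‖ψ l‖ ^ 2 := by
  have sum₁ : HasSum (fun l => (⟪φ (p.symm l), ψ (p.symm l)⟫_ℂ).re) (⟪φ, ψ⟫_ℂ).re :=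
    (Equiv.hasSum_iff p.symm).2 (hasSum_re_inner φ ψ)
  have sum₂ : HasSum (fun l => (⟪φ (p.symm l), ψ (q.symm l)⟫_ℂ).re)
      (⟪permUnitary p φ, permUnitary q ψ⟫_ℂ).re :=
    hasSum_re_inner (permUnitary p φ) (permUnitary q ψ)
  have reindex (r : Equiv.Perm ι) (w : ι → ℝ) (hw : ∀ l, 0 ≤ w l) (hwB : ∀ l, w l ≤ B)
      (hwr : ∀ l, w (r l) = w l) (χ : KetSpace ι) :
      HasSum (fun l => w l * ‖χ (r.symm l)‖ ^ 2) (∑' l, w l * ‖χ l‖ ^ 2) := by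
    have h := (Equiv.hasSum_iff r.symm).2 (summable_weight_mul_norm_sq hw hwB χ).hasSum
    refine h.congr_fun ?_
    intro l
    simp [Function.comp, ← hwr (r.symm l)]
  -- Both inner products evaluate `φ` at `p.symm l`, but `ψ` at `p.symm l` in one and `q.symm l` in
  -- the other; hence the average of two reindexed `v`-masses.
  have bound := ((reindex p u hu huB hup φ).add
    (((reindex p v hv hvB hvp ψ).add (reindex q v hv hvB hvq ψ)).mul_left (1 / 2)))
  refine (hasSum_le (fun l => ?_) (sum₁.sub sum₂) bound).trans (le_of_eq (by ring))
  rcases huv l with ⟨hl, hpq⟩ | hl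
  · rw [hpq, sub_self, hl]
    have := hv l
    positivity
  · have h₁ := (abs_le.1 (abs_re_inner_le_norm_mul (φ (p.symm l)) (ψ (p.symm l)))).2
    have h₂ := (abs_le.1 (abs_re_inner_le_norm_mul (φ (p.symm l)) (ψ (q.symm l)))).1
    -- Weighted AM-GM: since `u l * v l = 1`, the gap is half of `u l * (a - v l * b) ^ 2`.
    have amgm (a b : ℝ) : a * b ≤ 1 / 2 * (u l * a ^ 2 + v l * b ^ 2) := by
      have hvne : v l ≠ 0 := right_ne_zero_of_mul_eq_one hl
      have : u l * a ^ 2 + v l * b ^ 2 - 2 * (a * b) = u l * (a - v l * b) ^ 2 := by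
        linear_combination (2 * a * b - v l * b ^ 2) * hl
      have := mul_nonneg (hu l) (sq_nonneg (a - v l * b))
      linarith
    have a₁ := amgm ‖φ (p.symm l)‖ ‖ψ (p.symm l)‖
    have a₂ := amgm ‖φ (p.symm l)‖ ‖ψ (q.symm l)‖
    linarith

/-- The total overlap of the states along the edges of the hypercube. -/
noncomputable def edgeOverlap {n : ℕ} {ι : Type*} (ψ : (Fin n → Bool) → KetSpace ι) : ℝ :=
  ∑ c, ∑ i, (⟪ψ c, ψ (flipBit i c)⟫_ℂ).re

/-- The adversary weight of an edge of the hypercube with values `a` and `b` at its ends. -/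
noncomputable def edgeWeight (r a b : ℝ) : ℝ :=
  if a < b then r⁻¹ else if b < a then r else 0

theorem edgeWeight_nonneg {r : ℝ} (hr : 1 ≤ r) (a b : ℝ) : 0 ≤ edgeWeight r a b := by
  unfold edgeWeight
  split_ifs <;> positivity

theorem edgeWeight_le {r : ℝ} (hr : 1 ≤ r) (a b : ℝ) : edgeWeight r a b ≤ r := by
  have := inv_le_one_of_one_le₀ hr
  unfold edgeWeight
  split_ifs <;> linarith

theorem edgeWeight_le_inv {r a b : ℝ} (hr : 1 ≤ r) (hab : a ≤ b) : edgeWeight r a b ≤ r⁻¹ := by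
  have : 0 ≤ r⁻¹ := by positivity
  unfold edgeWeight
  rw [if_neg hab.not_gt]
  split_ifs <;> linarith

theorem edgeWeight_self (r a : ℝ) : edgeWeight r a a = 0 := by
  simp [edgeWeight]

/-- Reciprocal weights at the two ends of an edge are what the weighted AM-GM step requires. -/
theorem edgeWeight_mul_swap {r a b : ℝ} (hr : 1 ≤ r) (hab : a ≠ b) :
    edgeWeight r a b * edgeWeight r b a = 1 := by
  have hr0 : r ≠ 0 := by positivity
  rcases hab.lt_or_gt with h | h <;>
  simp [edgeWeight, h, h.not_gt, hr0]

/-- Only the exceptional flip `j` can carry the large weight `r`. The choice `r = √n` balances the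
two terms. -/
theorem sum_edgeWeight_le {n : ℕ} {r : ℝ} (hr : 1 ≤ r) {a : ℝ} {b : Fin n → ℝ}
    (h : ∃ j, ∀ i ≠ j, a ≤ b i) : ∑ i, edgeWeight r a (b i) ≤ n * r⁻¹ + r := by
  obtain ⟨j, hj⟩ := h
  have hr0 : 0 ≤ r⁻¹ := by positivity
  calc ∑ i, edgeWeight r a (b i) ≤ ∑ i, (r⁻¹ + if i = j then r else 0) := by
        refine Finset.sum_le_sum fun i _ => ?_
        by_cases hij : i = j
        · have := edgeWeight_le hr a (b i)
          simp only [hij, if_true] at *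
          linarith
        · simpa [hij] using edgeWeight_le_inv hr (hj i hij)
    _ = n * r⁻¹ + r := by simp [Finset.sum_add_distrib]

/-- One query whose answer at each point can be decreased by at most one bit flip lowers the edge
overlap by at most `4 √n 2ⁿ`. -/
theorem edgeOverlap_sub_le {n : ℕ} (hn : 1 ≤ n) {X ι : Type*} (π : ι → X)
    (p : (Fin n → Bool) → Equiv.Perm ι) (g : (Fin n → Bool) → X → ℝ)
    (hp : ∀ c l, π (p c l) = π l)
    (hg : ∀ c c' l, g c (π l) = g c' (π l) → p c l = p c' l)
    (hsens : ∀ c x, ∃ j, ∀ i ≠ j, g c x ≤ g (flipBit i c) x)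
    (ψ : (Fin n → Bool) → KetSpace ι) (hψ : ∀ c, ‖ψ c‖ = 1) :
    edgeOverlap ψ - edgeOverlap (fun c => permUnitary (p c) (ψ c)) ≤ 4 * √n * 2 ^ n := by
  have hr : 1 ≤ √(n : ℝ) := Real.one_le_sqrt.2 (by exact_mod_cast hn)
  set w : (Fin n → Bool) → Fin n → ι → ℝ :=
    fun c i l => edgeWeight √n (g c (π l)) (g (flipBit i c) (π l)) with hw
  have hw0 c i l : 0 ≤ w c i l := edgeWeight_nonneg hr _ _
  have hwr c i l : w c i l ≤ √n := edgeWeight_le hr _ _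
  have hwp c i d l : w c i (p d l) = w c i l := by simp only [hw, hp]
  set M : (Fin n → Bool) → Fin n → ℝ := fun c i => ∑' l, w c i l * ‖ψ c l‖ ^ 2
  have edge c i : (⟪ψ c, ψ (flipBit i c)⟫_ℂ).re -
      (⟪permUnitary (p c) (ψ c), permUnitary (p (flipBit i c)) (ψ (flipBit i c))⟫_ℂ).re ≤
      M c i + M (flipBit i c) i := by
    refine re_inner_sub_re_inner_permUnitary_le _ _ (hw0 _ _) (hw0 _ _) (hwr _ _) (hwr _ _)
      (hwp _ _ _) (hwp _ _ _) (hwp _ _ _) (fun l => ?_) _ _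
    by_cases hl : g c (π l) = g (flipBit i c) (π l)
    · refine Or.inl ⟨by simp only [hw, hl, edgeWeight_self], ?_⟩
      -- Queries fix the query register, so equality of the two answers at `l` carries over to its
      -- preimage, where the permutations then agree.
      have hm : π ((p c).symm l) = π l := by
        rw [← hp c, Equiv.apply_symm_apply]
      rw [← hm] at hl
      rw [Equiv.eq_symm_apply, ← hg _ _ _ hl, Equiv.apply_symm_apply]
    · refine Or.inr ?_
      simp only [hw, flipBit_involutive i c]
      exact edgeWeight_mul_swap hr hl
  have mass c : ∑ i, M c i ≤ 2 * √n := by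
    have hsum i : Summable fun l => w c i l * ‖ψ c l‖ ^ 2 :=
      summable_weight_mul_norm_sq (hw0 c i) (hwr c i) (ψ c)
    rw [← Summable.tsum_finsetSum fun i _ => hsum i]
    calc ∑' l, ∑ i, w c i l * ‖ψ c l‖ ^ 2 ≤ ∑' l, 2 * √n * ‖ψ c l‖ ^ 2 := by
          refine Summable.tsum_le_tsum (fun l => ?_) (summable_sum fun i _ => hsum i)
            ((summable_norm_sq (ψ c)).mul_left _)
          rw [← Finset.sum_mul]
          refine mul_le_mul_of_nonneg_right ?_ (sq_nonneg _)
          refine (sum_edgeWeight_le hr (hsens c (π l))).trans (le_of_eq ?_)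
          rw [← div_eq_mul_inv, Real.div_sqrt]
          ring
      _ = 2 * √n := by rw [tsum_mul_left, tsum_norm_sq, hψ]; ring
  -- For each `i`, flipping bit `i` permutes the strings, so both ends of the edges contribute the
  -- same total mass.
  have swap : ∑ c, ∑ i, M (flipBit i c) i = ∑ c, ∑ i, M c i := by
    rw [Finset.sum_comm, Finset.sum_comm (f := fun c i => M c i)]
    exact Finset.sum_congr rfl fun i _ =>
      Equiv.sum_comp (flipBit_involutive i).toPerm fun c => M c i
  calc edgeOverlap ψ - edgeOverlap (fun c => permUnitary (p c) (ψ c))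
      ≤ ∑ c, ∑ i, (M c i + M (flipBit i c) i) := by
        simp only [edgeOverlap, ← Finset.sum_sub_distrib]
        exact Finset.sum_le_sum fun c _ => Finset.sum_le_sum fun i _ => edge c i
    _ = 2 * ∑ c, ∑ i, M c i := by
        simp only [Finset.sum_add_distrib, swap]
        ring
    _ ≤ 2 * ∑ _c : Fin n → Bool, 2 * √n := by
        gcongr with c
        exact mass c
    _ = 4 * √n * 2 ^ n := by
        simp
        ring

theorem edgeOverlap_map {n : ℕ} {ι : Type*} (U : KetSpace ι ≃ₗᵢ[ℂ] KetSpace ι)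
    (ψ : (Fin n → Bool) → KetSpace ι) : edgeOverlap (fun c => U (ψ c)) = edgeOverlap ψ := by
  simp only [edgeOverlap, LinearIsometryEquiv.inner_map_map]

/-- If only the queries of kind `k` lower the edge overlap, then the total loss is bounded by their
number. -/
theorem edgeOverlap_sub_foldl_le {n : ℕ} {ι : Type*} {B : ℝ} (k : QueryKind)
    (O : (Fin n → Bool) → QueryKind → (KetSpace ι ≃ₗᵢ[ℂ] KetSpace ι))
    (hO : ∀ k' (ψ : (Fin n → Bool) → KetSpace ι), (∀ c, ‖ψ c‖ = 1) →
      edgeOverlap ψ - edgeOverlap (fun c => O c k' (ψ c)) ≤ if k' = k then B else 0)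
    (steps : List (QueryKind × (KetSpace ι ≃ₗᵢ[ℂ] KetSpace ι)))
    (ψ : (Fin n → Bool) → KetSpace ι) (hψ : ∀ c, ‖ψ c‖ = 1) :
    edgeOverlap ψ - edgeOverlap (fun c => steps.foldl (fun φ p => p.2 (O c p.1 φ)) (ψ c)) ≤
      steps.countP (fun p => p.1 = k) * B := by
  induction steps generalizing ψ with
  | nil => simp
  | cons p steps ih =>
    have h₁ := hO p.1 ψ hψ
    have h₂ := ih (fun c => p.2 (O c p.1 (ψ c))) (fun c => by simp [hψ c])
    rw [edgeOverlap_map] at h₂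
    simp only [List.foldl_cons, List.countP_cons, decide_eq_true_eq]
    push_cast
    by_cases hk : p.1 = k
    · simp only [hk, if_true] at *
      linarith
    · simp only [hk, if_false] at *
      linarith

/-- States whose measurements land in disjoint sets with probability at least `4 / 5` each have
overlap at most `4 / 5`. -/
theorem re_inner_le_of_disjoint {ι : Type*} (φ ψ : KetSpace ι) (hφ : ‖φ‖ = 1) (hψ : ‖ψ‖ = 1)
    {S T : Set ι} [DecidablePred (· ∈ S)] [DecidablePred (· ∈ T)] (hST : Disjoint S T)
    (hS : 4 / 5 ≤ ∑' l, if l ∈ S then ‖φ l‖ ^ 2 else 0)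
    (hT : 4 / 5 ≤ ∑' l, if l ∈ T then ‖ψ l‖ ^ 2 else 0) : (⟪φ, ψ⟫_ℂ).re ≤ 4 / 5 := by
  have hsum (χ : KetSpace ι) (R : Set ι) [DecidablePred (· ∈ R)] :
      Summable fun l => if l ∈ R then ‖χ l‖ ^ 2 else 0 :=
    Summable.of_nonneg_of_le (fun l => by split_ifs <;> positivity)
      (fun l => by split_ifs <;> first | exact le_rfl | positivity) (summable_norm_sq χ)
  have hφsum := (summable_norm_sq φ).hasSum
  have hψsum := (summable_norm_sq ψ).hasSum
  rw [tsum_norm_sq, hφ] at hφsum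
  rw [tsum_norm_sq, hψ] at hψsum
  -- The factor `3 / 4` leaves `‖φ l‖ ^ 2 / 4 + ‖ψ l‖ ^ 2` on `S`, and symmetrically on `T`, which
  -- still dominates `‖φ l‖ * ‖ψ l‖`. The total is at most `2 - 3 / 4 * (8 / 5) = 4 / 5`.
  have bound := ((hφsum.add hψsum).sub
    (((hsum φ S).hasSum.add (hsum ψ T).hasSum).mul_left (3 / 4)))
  refine (hasSum_le (fun l => ?_) (hasSum_re_inner φ ψ) bound).trans (by linarith)
  have h := (abs_le.1 (abs_re_inner_le_norm_mul (φ l) (ψ l))).2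
  by_cases hlS : l ∈ S
  · have hlT : l ∉ T := Set.disjoint_left.1 hST hlS
    simp only [hlS, hlT, if_true, if_false]
    nlinarith [sq_nonneg (‖φ l‖ - 2 * ‖ψ l‖)]
  · by_cases hlT : l ∈ T
    · simp only [hlS, hlT, if_true, if_false]
      nlinarith [sq_nonneg (2 * ‖φ l‖ - ‖ψ l‖)]
    · simp only [hlS, hlT, if_false]
      nlinarith [sq_nonneg (‖φ l‖ - ‖ψ l‖), sq_nonneg ‖φ l‖, sq_nonneg ‖ψ l‖]

/-! ### Query lower bounds from the adversary potential -/

namespace QuantumAlgorithm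

variable {X W : Type*}

theorem norm_finalState (A : QuantumAlgorithm X W) (K : Set X) (f : X → ℝ) :
    ‖A.finalState K f‖ = 1 := by
  have h (steps : List (QueryKind × (KetSpace (Label X W) ≃ₗᵢ[ℂ] KetSpace (Label X W))))
      (ψ : KetSpace (Label X W)) :
      ‖steps.foldl (fun φ p => p.2 (oracle W K f p.1 φ)) ψ‖ = ‖ψ‖ := by
    induction steps generalizing ψ with
    | nil => rfl
    | cons p steps ih => simp [ih]
  exact (h _ _).trans A.norm_init

/-- The adversary bound for families of oracles `(K c, f c)` indexed by the hypercube. -/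
theorem sqrt_le_countP (A : QuantumAlgorithm X W) {n : ℕ} (hn : 1 ≤ n) (k : QueryKind)
    (K : (Fin n → Bool) → Set X) (f : (Fin n → Bool) → X → ℝ) (S : (Fin n → Bool) → Set X)
    (hS : ∀ c c', c ≠ c' → Disjoint (S c) (S c'))
    (hA : ∀ c, 4 / 5 ≤ A.outputProb (K c) (f c) (S c))
    (hO : ∀ k' (ψ : (Fin n → Bool) → KetSpace (Label X W)), (∀ c, ‖ψ c‖ = 1) →
      edgeOverlap ψ - edgeOverlap (fun c => oracle W (K c) (f c) k' (ψ c)) ≤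
        if k' = k then 4 * √n * 2 ^ n else 0) :
    √n / 20 ≤ (A.steps.countP (fun p => p.1 = k) : ℝ) := by
  classical
  have total := edgeOverlap_sub_foldl_le k (fun c => oracle W (K c) (f c)) hO A.steps
    (fun _ => A.init) (fun _ => A.norm_init)
  have start : edgeOverlap (fun _ : Fin n → Bool => A.init) = 2 ^ n * n := by
    simp [edgeOverlap, inner_self_eq_norm_sq_to_K, A.norm_init]
  have finish : edgeOverlap (fun c => A.finalState (K c) (f c)) ≤ 2 ^ n * (n * (4 / 5)) := by
    calc edgeOverlap (fun c => A.finalState (K c) (f c))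
        ≤ ∑ _c : Fin n → Bool, ∑ _i : Fin n, (4 / 5 : ℝ) := by
          refine Finset.sum_le_sum fun c _ => Finset.sum_le_sum fun i _ => ?_
          refine re_inner_le_of_disjoint _ _ (A.norm_finalState _ _) (A.norm_finalState _ _)
            (S := A.output ⁻¹' S c) (T := A.output ⁻¹' S (flipBit i c))
            ((hS _ _ (flipBit_ne i c).symm).preimage _) ?_ ?_
          · convert hA c using 1
            simp only [outputProb, Set.mem_preimage]
          · convert hA (flipBit i c) using 1
            simp only [outputProb, Set.mem_preimage]
      _ = 2 ^ n * (n * (4 / 5)) := by simp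
  rw [start] at total
  set N : ℝ := (A.steps.countP (fun p => p.1 = k) : ℝ)
  have total' : (2 : ℝ) ^ n * n - 2 ^ n * (n * (4 / 5)) ≤ N * (4 * √n * 2 ^ n) :=
    (sub_le_sub_left finish _).trans total
  have hpos : (0 : ℝ) < 4 * √n * 2 ^ n := by
    have : (0 : ℝ) < n := by exact_mod_cast hn
    positivity
  refine le_of_mul_le_mul_right (le_trans (le_of_eq ?_) total') hpos
  linear_combination (1 / 5 : ℝ) * 2 ^ n * Real.mul_self_sqrt (Nat.cast_nonneg (α := ℝ) n)

theorem sqrt_le_memQueries {n : ℕ} (hn : 2 ≤ n) (A : QuantumAlgorithm (Point n) W)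
    (hA : ∀ s c : Fin n → Bool, 4 / 5 ≤ A.outputProb (body s) (objective c)
      (approxMinimizers (body s) (objective c) (1 / 3))) :
    √n / 20 ≤ (A.memQueries : ℝ) := by
  have : Nonempty (Fin n) := ⟨⟨0, by omega⟩⟩
  let c : Fin n → Bool := fun _ => false
  refine A.sqrt_le_countP (by omega) QueryKind.mem body (fun _ => objective c) _
    (fun s s' hs => Set.disjoint_left.2 fun x hx hx' =>
      hs (eq_of_mem_approxMinimizers hx hx').1) (fun s => hA s c) ?_
  rintro (_ | _) ψ hψ
  · refine edgeOverlap_sub_le (by omega) Prod.fst (fun s => memPerm W (body s)) nonMembership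
      (fun _ _ => rfl) ?_ exists_forall_ne_nonMembership_le ψ hψ
    rintro s s' ⟨x, b, y, w⟩ h
    have hiff : x ∈ body s ↔ x ∈ body s' := by
      by_cases h₁ : x ∈ body s <;> by_cases h₂ : x ∈ body s' <;>
        simp_all [nonMembership]
    simp [memPerm, hiff]
  -- With `c` fixed, an evaluation query is the same unitary for every `s`, so it preserves all
  -- overlaps.
  · simp only [oracle, reduceCtorEq, if_false]
    rw [edgeOverlap_map, sub_self]

theorem sqrt_le_evalQueries {n : ℕ} (hn : 2 ≤ n) (A : QuantumAlgorithm (Point n) W)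
    (hA : ∀ s c : Fin n → Bool, 4 / 5 ≤ A.outputProb (body s) (objective c)
      (approxMinimizers (body s) (objective c) (1 / 3))) :
    √n / 20 ≤ (A.evalQueries : ℝ) := by
  have : Nonempty (Fin n) := ⟨⟨0, by omega⟩⟩
  let s : Fin n → Bool := fun _ => false
  refine A.sqrt_le_countP (by omega) QueryKind.eval (fun _ => body s) objective _
    (fun c c' hc => Set.disjoint_left.2 fun x hx hx' =>
      hc (eq_of_mem_approxMinimizers hx hx').2) (fun c => hA s c) ?_
  rintro (_ | _) ψ hψ
  -- With `s` fixed, a membership query is the same unitary for every `c`.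
  · simp only [oracle, reduceCtorEq, if_false]
    rw [edgeOverlap_map, sub_self]
  · refine edgeOverlap_sub_le (by omega) Prod.fst (fun c => evalPerm W (objective c)) objective
      (fun _ _ => rfl) ?_ exists_forall_ne_objective_le ψ hψ
    rintro c c' ⟨x, b, y, w⟩ h
    simpa [evalPerm] using h

end QuantumAlgorithm

theorem theorem2 :
    ∃ C : ℝ, 0 < C ∧ ∀ n : ℕ, 2 ≤ n →
      (∀ s c : Fin n → Bool,
        Convex ℝ (body s) ∧ IsCompact (body s) ∧ (interior (body s)).Nonempty ∧
          ConvexOn ℝ (body s) (objective c)) ∧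
      ∀ (W : Type) (A : QuantumAlgorithm (Point n) W),
        (∀ s c : Fin n → Bool,
          4 / 5 ≤ A.outputProb (body s) (objective c)
            (approxMinimizers (body s) (objective c) (1 / 3))) →
        C * √(n : ℝ) ≤ (A.memQueries : ℝ) ∧
          C * (√(n : ℝ) / Real.log (n : ℝ)) ≤ (A.evalQueries : ℝ) := by
  -- `1 / 40` is half of `1 / 20`: since `log n ≥ log 2 ≥ 1 / 2`, dividing by `log n` can at most
  -- double `√n`.
  refine ⟨1 / 40, by norm_num, fun n hn => ⟨fun s c => ⟨convex_body s, isCompact_body s,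
    interior_body_nonempty s, convexOn_objective s c⟩, fun W A hA => ⟨?_, ?_⟩⟩⟩
  · have := A.sqrt_le_memQueries hn hA
    have := Real.sqrt_nonneg (n : ℝ)
    linarith
  · have h := A.sqrt_le_evalQueries hn hA
    have hlog : 1 / 2 ≤ Real.log n :=
      (by linarith [Real.log_two_gt_d9] : 1 / 2 ≤ Real.log 2).trans
        (Real.log_le_log (by norm_num) (by exact_mod_cast hn))
    have hdiv : √(n : ℝ) / Real.log n ≤ √n / (1 / 2) := by
      gcongr
    linarith
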